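/- Let $n, k$ be natural numbers with $1 \le k \le n$, and let $B_n$ be the hyperoctahedral group of all permutations of $\{-n,\dots,-1\} \cup \{1,\dots,n\}$ that permute the blocks $\{-1,1\},\dots,\{-n,n\}$. An element $\sigma \in B_n$ is regarded as the shuffle of a deck of $n$ cards that moves the card in position $i$ to position $|\sigma(i)|$ and turns it over if and only if $\sigma(i) < 0$. An oriented $k$-shuffle is performed as follows: remove any $k$ cards from the deck; choose any $j \in \{0,1,\dots,k\}$ of these $k$ cards and flip these $j$ cards over as a block (which reverses their order); place the $j$ flipped cards on top of the deck; then put the $k-j$ unflipped cards, in their original order, on top of them. There are $2^k\binom{n}{k}$ oriented $k$-shuffles, and the identity is one of them. Let $P^\dagger(k)$ be the transition matrix of the Markov chain on $B_n$ in which each step applies an oriented $k$-shuffle chosen uniformly at random, and let $P^{\dagger\prime}(k)$ be the transition matrix of the analogous chain in which each step applies a non-identity oriented $k$-shuffle chosen uniformly at random. Let $\pi^\dagger_k$ be the permutation character of $B_n$ acting on the cosets of the parabolic subgroup $S_k \times (C_2 \wr S_{n-k})$, where $S_k$ permutes $1,\dots,k$ (and correspondingly $-1,\dots,-k$) without sign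 changes and $C_2 \wr S_{n-k}$ is the hyperoctahedral group on $\{\pm(k+1),\dots,\pm n\}$. Then, counted with multiplicity, the eigenvalues of $P^\dagger(k)$ are the numbers $$\frac{\pi^\dagger_k(\tau)}{2^k\binom{n}{k}} \qquad (\tau \in B_n),$$ and the eigenvalues of $P^{\dagger\prime}(k)$ are the numbers $$\frac{\pi^\dagger_k(\tau)-1}{2^k\binom{n}{k}-1} \qquad (\tau \in B_n).$$ -/

import Mathlib

open scoped Pointwise

/-- The `2n` points `{-1, …, -n} ∪ {1, …, n}`: the pair `(i, 1)` stands for `i + 1` and `(i, -1)`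
for `-(i + 1)`.  For a deck of `n` cards, `(i, 1)` is the card `i` face-up and `(i, -1)` is the
card `i` face-down; positions are numbered from the top of the deck, the top one being `0`. -/
abbrev SignedPoint (n : ℕ) : Type := Fin n × ℤˣ

/-- The negation `x ↦ -x` on `{-1, …, -n} ∪ {1, …, n}`, that is, turning a card over. -/
def SignedPoint.flip {n : ℕ} (x : SignedPoint n) : SignedPoint n := (x.1, -x.2)

/-- The hyperoctahedral group: all permutations of `{-1, …, -n} ∪ {1, …, n}` that permute the blocks
`{-1, 1}, …, {-n, n}`; equivalently, those that commute with negation.  The group element `σ` moves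
the card in position `i` to the position `p` with `σ (i, 1) = (p, ε)`, and turns it over if and only
if `ε = -1`. -/
def hyperoctahedral (n : ℕ) : Subgroup (Equiv.Perm (SignedPoint n)) where
  carrier := {σ | ∀ x, σ x.flip = (σ x).flip}
  one_mem' := fun _ => rfl
  mul_mem' := by
    intro σ τ hσ hτ x
    rw [Equiv.Perm.mul_apply, Equiv.Perm.mul_apply, hτ x, hσ (τ x)]
  inv_mem' := by
    intro σ hσ x
    rw [Equiv.Perm.inv_eq_iff_eq, hσ]
    exact congrArg SignedPoint.flip (σ.apply_symm_apply x).symm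

instance hyperoctahedral.decidableMem (n : ℕ) : DecidablePred (· ∈ hyperoctahedral n) :=
  fun σ => decidable_of_iff (∀ x, σ x.flip = (σ x).flip) Iff.rfl

/-- The deck after the shuffle `σ` of the deck of face-up cards `0, 1, …, n - 1`, listed from the top.
The entry in position `p` is the card `i` with orientation `ε` where `σ (i, 1) = (p, ε)`; this
condition is the same as `σ (i, ε) = (p, 1)`. -/
def deckAfter {n : ℕ} (σ : hyperoctahedral n) : List (SignedPoint n) :=
  List.ofFn fun p : Fin n => (σ : Equiv.Perm (SignedPoint n))⁻¹ (p, 1)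

/-- Remove the cards in `R` from the deck of face-up cards `0, 1, …, n - 1`, and turn over the cards
in `F ⊆ R` as a block (so their order is reversed).  On top of the rest of the deck place the block of
flipped cards, and on top of this put the remaining cards of `R` (all other orders being
preserved).  The result is listed from the top. -/
def shuffledDeck {n : ℕ} (R F : Finset (Fin n)) : List (SignedPoint n) :=
  ((List.finRange n).filter (fun i => i ∈ R ∧ i ∉ F)).map (fun i => (i, 1)) ++
  (((List.finRange n).filter (fun i => i ∈ F)).reverse).map (fun i => (i, -1)) ++
  ((List.finRange n).filter (fun i => i ∉ R)).map (fun i => (i, 1))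

/-- `σ` is an oriented `k`-shuffle: some `k` cards are removed, and some of these are flipped. -/
def IsOrientedShuffle {n : ℕ} (k : ℕ) (σ : hyperoctahedral n) : Prop :=
  ∃ R F : Finset (Fin n), R.card = k ∧ F ⊆ R ∧ deckAfter σ = shuffledDeck R F

instance IsOrientedShuffle.decidable {n : ℕ} (k : ℕ) (σ : hyperoctahedral n) :
    Decidable (IsOrientedShuffle k σ) := by
  unfold IsOrientedShuffle
  infer_instance

/-- The set of all oriented `k`-shuffles of a deck of `n` cards. -/
def orientedShuffles (n k : ℕ) : Finset (hyperoctahedral n) :=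
  Finset.univ.filter fun σ => IsOrientedShuffle k σ

/-- The transition matrix of the Markov chain on `G` in which each step applies an element of `S`
chosen uniformly at random.  From `σ` the step `s` leads to "first `σ`, then `s`", which is the
composite `s * σ` of permutations; so the entry at `(σ, τ)` is nonzero when `τ * σ⁻¹ ∈ S`. -/
noncomputable def uniformStepMatrix {G : Type*} [Group G] [DecidableEq G] (S : Finset G) :
    Matrix G G ℝ :=
  Matrix.of fun σ τ => if τ * σ⁻¹ ∈ S then (S.card : ℝ)⁻¹ else 0

/-- The subgroup `S_k × (C_2 ≀ S_{n-k})` of the hyperoctahedral group, where `S_k` permutes the first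
`k` cards without flips and `C_2 ≀ S_{n-k}` is the hyperoctahedral group on the other `n - k` cards.
It consists of all elements that map `{1, …, k}` (with positive signs) to itself, since these also
preserve `{-1, …, -k}` and hence `{±(k+1), …, ±n}`. -/
def parabolicSubgroup (n k : ℕ) : Subgroup (hyperoctahedral n) :=
  MulAction.stabilizer (hyperoctahedral n) {x : SignedPoint n | (x.1 : ℕ) < k ∧ x.2 = 1}

/-- The permutation character of `G` on the cosets of `H`: the number of cosets fixed by `τ`. -/
noncomputable def permutationCharacter {G : Type*} [Group G] (H : Subgroup G) (τ : G) : ℕ :=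
  Nat.card (MulAction.fixedBy (G ⧸ H) τ)

/-! ### Eigenvalues from traces of powers -/

section TracePowers

open Polynomial

variable {K ι : Type*} [Fintype ι] [DecidableEq ι]

/-! Let `M` be the 0/1 matrix of the oriented shuffles. In characteristic zero power sums determine
a multiset, so it suffices that the trace of `M ^ m` is the sum of `π(τ) ^ m` over the group, where
`π` is the permutation character (`trace_pow_orientedShuffles`). The two transition matrices are
polynomials of degree one in `M`.

A deck is a linear order on the signed points that negation reverses. A shuffle moves a signed set
`A` to the front of this order and `-A` to the back; `A` runs over the orbit of `topSet n k`, whose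
stabilizer is the parabolic subgroup. So the trace counts pairs of a deck and a word of `m` signed
sets whose successive moves fix the deck, while the sum of `π(τ) ^ m` counts pairs of a signed
permutation and a word of `m` signed sets that it fixes.

These counts agree word by word (`card_moveAllToTop_eq_self`). Successive moves sort the points
lexicographically by their blocks, so the fixed decks are those already sorted. Any two of them
differ by a signed permutation preserving all blocks, that is, fixing every set of the word. -/

theorem Polynomial.monoidHom_ext_of_isAlgClosed [Field K] [IsAlgClosed K] {M : Type*} [CommMonoid M]
    {φ ψ : K[X] →* M} (hC : ∀ c, φ (C c) = ψ (C c)) (hX : ∀ a, φ (X - C a) = ψ (X - C a)) :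
    φ = ψ := by
  ext p
  rw [(IsAlgClosed.splits p).eq_prod_roots]
  simp [map_multiset_prod, hC, hX, Multiset.map_map]

/-- Both sides are multiplicative in `p`, so constants and the factors `X - C a` suffice; at the
latter both are the characteristic polynomial at `a` up to sign. -/
theorem Matrix.det_aeval_eq_prod_roots_charpoly [Field K] [IsAlgClosed K] (A : Matrix ι ι K)
    (p : K[X]) : (aeval A p).det = (A.charpoly.roots.map fun z => p.eval z).prod := by
  have hcard : A.charpoly.roots.card = Fintype.card ι := by
    rw [← A.charpoly_natDegree_eq_dim, (IsAlgClosed.splits A.charpoly).natDegree_eq_card_roots]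
  let φ : K[X] →* K := Matrix.detMonoidHom.comp ((aeval A : K[X] →ₐ[K] _) : K[X] →* Matrix ι ι K)
  let ψ : K[X] →* K :=
    { toFun := fun p => (A.charpoly.roots.map fun z => p.eval z).prod
      map_one' := by simp
      map_mul' := by simp [Multiset.prod_map_mul] }
  have h : φ = ψ := by
    apply Polynomial.monoidHom_ext_of_isAlgClosed
    · intro c
      simp [φ, ψ, hcard, Matrix.algebraMap_eq_diagonal]
    · intro a
      have h1 : φ (X - C a) = (-1) ^ Fintype.card ι * A.charpoly.eval a := by
        rw [Matrix.eval_charpoly, ← Matrix.det_neg]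
        simp [φ, Matrix.algebraMap_eq_diagonal, Matrix.scalar_apply, Pi.algebraMap_def]
      have h2 : A.charpoly.eval a = (A.charpoly.roots.map fun z => a - z).prod := by
        conv_lhs => rw [(IsAlgClosed.splits A.charpoly).eq_prod_roots_of_monic A.charpoly_monic]
        simp [eval_multiset_prod, Multiset.map_map]
      have h3 : ψ (X - C a) = (A.charpoly.roots.map fun z => (-1) * (a - z)).prod := by
        simp [ψ]
      rw [h1, h2, h3, Multiset.prod_map_mul]
      simp [hcard]
  exact DFunLike.congr_fun h p

theorem Matrix.trace_pow_eq_sum_roots_charpoly [Field K] [IsAlgClosed K] (A : Matrix ι ι K)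
    (m : ℕ) : (A ^ m).trace = (A.charpoly.roots.map fun z => z ^ m).sum := by
  have hχ : (A ^ m).charpoly = ((A.charpoly.roots.map fun z => z ^ m).map fun z => X - C z).prod := by
    apply Polynomial.funext
    intro x
    -- With this polynomial the determinant is the characteristic polynomial of `A ^ m` at `x`.
    have := A.det_aeval_eq_prod_roots_charpoly (C x - X ^ m)
    rw [Matrix.eval_charpoly]
    simp only [map_sub, aeval_C, map_pow, aeval_X, eval_sub, eval_C, eval_pow, eval_X] at this
    simp only [Multiset.map_map, eval_multiset_prod, Function.comp_def, eval_sub, eval_X, eval_C]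
    rw [← this]
    simp [Matrix.algebraMap_eq_diagonal, Matrix.scalar_apply, Pi.algebraMap_def]
  rw [Matrix.trace_eq_sum_roots_charpoly, hχ, roots_multiset_prod_X_sub_C]

theorem Multiset.sum_map_eval_eq_of_sum_map_pow_eq [Field K] {s t : Multiset K}
    (h : ∀ m : ℕ, (s.map fun z => z ^ m).sum = (t.map fun z => z ^ m).sum) (p : K[X]) :
    (s.map fun z => p.eval z).sum = (t.map fun z => p.eval z).sum := by
  induction p using Polynomial.induction_on' with
  | add p q hp hq => simp [Multiset.sum_map_add, hp, hq]
  | monomial k a => simp [Multiset.sum_map_mul_left, h k]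

/-- A polynomial vanishing on all elements of `s` and `t` except `a` turns equal power sums into
equal multiplicities of `a`. -/
theorem Multiset.eq_of_sum_map_pow_eq [Field K] [CharZero K] {s t : Multiset K}
    (h : ∀ m : ℕ, (s.map fun z => z ^ m).sum = (t.map fun z => z ^ m).sum) : s = t := by
  classical
  ext a
  let u : Finset K := (s + t).toFinset.erase a
  let p : K[X] := ∏ b ∈ u, (X - C b)
  have hpa : p.eval a ≠ 0 := by
    simp only [p, eval_prod, eval_sub, eval_X, eval_C]
    exact Finset.prod_ne_zero_iff.2 fun b hb => sub_ne_zero.2 (Finset.ne_of_mem_erase hb).symm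
  have hp : ∀ z ∈ s + t, p.eval z = if a = z then p.eval a else 0 := by
    intro z hz
    split_ifs with haz
    · rw [haz]
    · simp only [p, eval_prod, eval_sub, eval_X, eval_C]
      exact Finset.prod_eq_zero
        (Finset.mem_erase.2 ⟨Ne.symm haz, Multiset.mem_toFinset.2 hz⟩) (sub_self z)
  have hsum : ∀ r : Multiset K, r ≤ s + t →
      (r.map fun z => p.eval z).sum = r.count a * p.eval a := by
    intro r hr
    rw [Multiset.map_congr rfl fun z hz => hp z (Multiset.mem_of_le hr hz)]
    clear hr
    induction r using Multiset.induction_on with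
    | empty => simp
    | cons b r ih =>
      rw [Multiset.map_cons, Multiset.sum_cons, ih, Multiset.count_cons]
      split_ifs <;> push_cast <;> ring
  have key := Multiset.sum_map_eval_eq_of_sum_map_pow_eq h p
  rw [hsum s (Multiset.le_add_right s t), hsum t (Multiset.le_add_left t s)] at key
  exact_mod_cast mul_right_cancel₀ hpa key

/-- A real matrix whose powers have as traces the power sums of the `μ i` has the `μ i` as its
eigenvalues. -/
theorem Matrix.roots_charpoly_of_trace_pow (A : Matrix ι ι ℝ) (μ : ι → ℝ)
    (h : ∀ m : ℕ, (A ^ m).trace = ∑ i, μ i ^ m) :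
    A.charpoly.roots = (Finset.univ : Finset ι).val.map μ := by
  -- Over `ℂ` the characteristic polynomial splits; its roots turn out real, so the factorization
  -- descends to `ℝ`.
  let B : Matrix ι ι ℂ := A.map (algebraMap ℝ ℂ)
  have hB : B.charpoly.roots = (Finset.univ : Finset ι).val.map fun i => (algebraMap ℝ ℂ) (μ i) := by
    apply Multiset.eq_of_sum_map_pow_eq
    intro m
    rw [← B.trace_pow_eq_sum_roots_charpoly m]
    have h1 : B ^ m = (A ^ m).map (algebraMap ℝ ℂ) :=
      (map_pow (algebraMap ℝ ℂ).mapMatrix A m).symm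
    have h2 : ((A ^ m).map (algebraMap ℝ ℂ)).trace = algebraMap ℝ ℂ (A ^ m).trace :=
      (AddMonoidHom.map_trace (algebraMap ℝ ℂ) (A ^ m)).symm
    rw [h1, h2, h m, map_sum, Multiset.map_map]
    simp only [map_pow]
    rfl
  have hχ : A.charpoly = ∏ i, (X - C (μ i)) := by
    apply Polynomial.map_injective (algebraMap ℝ ℂ) (algebraMap ℝ ℂ).injective
    rw [← Matrix.charpoly_map,
      (IsAlgClosed.splits (A.map (algebraMap ℝ ℂ)).charpoly).eq_prod_roots_of_monic
      (Matrix.charpoly_monic _), hB, Polynomial.map_prod, Multiset.map_map]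
    simp only [Polynomial.map_sub, map_X, map_C]
    rfl
  rw [hχ]
  have := roots_multiset_prod_X_sub_C ((Finset.univ : Finset ι).val.map μ)
  rwa [Multiset.map_map] at this

theorem Matrix.trace_aeval_of_trace_pow {R : Type*} [CommRing R] (A : Matrix ι ι R) (μ : ι → R)
    (h : ∀ m : ℕ, (A ^ m).trace = ∑ i, μ i ^ m) (p : R[X]) :
    (aeval A p).trace = ∑ i, p.eval (μ i) := by
  induction p using Polynomial.induction_on' with
  | add p q hp hq => simp [Finset.sum_add_distrib, hp, hq]
  | monomial k a =>
    simp [aeval_monomial, ← Algebra.smul_def, h k, Finset.mul_sum]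

/-- If the traces of the powers of `A` are the power sums of the `μ i`, then the eigenvalues of
`aeval A p` are the `p.eval (μ i)`. -/
theorem Matrix.roots_charpoly_aeval_of_trace_pow (A : Matrix ι ι ℝ) (μ : ι → ℝ)
    (h : ∀ m : ℕ, (A ^ m).trace = ∑ i, μ i ^ m) (p : ℝ[X]) :
    (aeval A p).charpoly.roots = (Finset.univ : Finset ι).val.map fun i => p.eval (μ i) := by
  apply Matrix.roots_charpoly_of_trace_pow
  intro m
  rw [← map_pow, A.trace_aeval_of_trace_pow μ h]
  simp

end TracePowers

/-! ### Decks as orders on the signed points -/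

namespace SignedPoint

variable {n : ℕ}

@[simp] theorem flip_flip (x : SignedPoint n) : x.flip.flip = x := by
  simp [flip]

/-- The height of a point in the order `1 < ⋯ < n < -n < ⋯ < -1`; it is an odd function. -/
def height (x : SignedPoint n) : ℤ := x.2 * ((x.1 : ℤ) - n)

theorem height_flip (x : SignedPoint n) : x.flip.height = -x.height := by
  simp [height, flip]

theorem height_neg_iff {x : SignedPoint n} : x.height < 0 ↔ x.2 = 1 := by
  obtain ⟨i, ε⟩ := x
  have := i.2
  rcases Int.units_eq_one_or ε with rfl | rfl <;> simp [height]

theorem abs_height_le (x : SignedPoint n) : |x.height| ≤ n := by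
  obtain ⟨i, ε⟩ := x
  have := i.2
  rcases Int.units_eq_one_or ε with rfl | rfl <;> simp [height, abs_le] <;> omega

theorem height_injective : Function.Injective (height : SignedPoint n → ℤ) := by
  rintro ⟨i, ε⟩ ⟨j, δ⟩ h
  have := i.2
  have := j.2
  rcases Int.units_eq_one_or ε with rfl | rfl <;> rcases Int.units_eq_one_or δ with rfl | rfl <;>
    simp [height, Fin.ext_iff] at h ⊢ <;> omega

/-- An enumeration of the signed points by increasing height. -/
theorem exists_equiv_height_strictMono (n : ℕ) :
    ∃ e : Fin (Fintype.card (SignedPoint n)) ≃ SignedPoint n, StrictMono (height ∘ e) := by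
  let e := (Fintype.equivFin (SignedPoint n)).symm
  refine ⟨(Tuple.sort (height ∘ e)).trans e, ?_⟩
  exact (Tuple.monotone_sort (height ∘ e)).strictMono_of_injective
    (height_injective.comp ((Tuple.sort (height ∘ e)).trans e).injective)

/-- A function on the signed points has only one increasing rearrangement. -/
theorem comp_eq_comp_of_monotone {α : Type*} [LinearOrder α] (f : SignedPoint n → α)
    (σ τ : Equiv.Perm (SignedPoint n))
    (hσ : ∀ x y, x.height < y.height → f (σ x) ≤ f (σ y))
    (hτ : ∀ x y, x.height < y.height → f (τ x) ≤ f (τ y)) (x : SignedPoint n) :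
    f (σ x) = f (τ x) := by
  obtain ⟨e, he⟩ := exists_equiv_height_strictMono n
  have mono : ∀ ρ : Equiv.Perm (SignedPoint n),
      (∀ x y, x.height < y.height → f (ρ x) ≤ f (ρ y)) →
      (f ∘ e) ∘ (e.permCongr.symm ρ) = (f ∘ e) ∘ Tuple.sort (f ∘ e) := by
    intro ρ hρ
    apply Tuple.comp_sort_eq_comp_iff_monotone.2
    intro i j hij
    rcases hij.eq_or_lt with rfl | hij
    · rfl
    · simpa [Equiv.permCongr_symm, Equiv.permCongr_apply] using hρ _ _ (he hij)
  have h := congrFun ((mono σ hσ).trans (mono τ hτ).symm) (e.symm x)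
  simpa [Equiv.permCongr_symm, Equiv.permCongr_apply] using h

end SignedPoint

namespace hyperoctahedral

open SignedPoint

variable {n : ℕ}

theorem apply_flip (σ : hyperoctahedral n) (x : SignedPoint n) : σ • x.flip = (σ • x).flip :=
  σ.2 x

/-- Both inverses rearrange the injective function `(τ • x).height` increasingly, and such a
rearrangement is unique. A deck is thus determined by its order. -/
theorem eq_of_height_lt_imp {σ τ : hyperoctahedral n}
    (h : ∀ x y : SignedPoint n, (σ • x).height < (σ • y).height → (τ • x).height < (τ • y).height) :
    σ = τ := by
  have key := comp_eq_comp_of_monotone (fun x => (τ • x).height) (σ⁻¹ : Equiv.Perm (SignedPoint n))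
    (τ⁻¹ : Equiv.Perm (SignedPoint n)) (by
      intro x y hxy
      refine (h _ _ ?_).le
      simpa [Subgroup.smul_def] using hxy) (by
      intro x y hxy
      simpa [Subgroup.smul_def] using hxy.le)
  apply inv_injective
  ext1
  ext1 x
  have h1 := height_injective (key x)
  exact MulAction.injective τ h1

/-- For an injective odd function `f` there is a signed permutation that sorts the signed points
by their values under `f`. -/
theorem exists_height_lt_iff (f : SignedPoint n → ℤ) (hf : Function.Injective f)
    (hodd : ∀ x : SignedPoint n, f x.flip = -f x) :
    ∃ σ : hyperoctahedral n, ∀ x y : SignedPoint n,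
      (σ • x).height < (σ • y).height ↔ f x < f y := by
  obtain ⟨e, he⟩ := exists_equiv_height_strictMono n
  let s := Tuple.sort (f ∘ e)
  have hs : StrictMono ((f ∘ e) ∘ s) :=
    (Tuple.monotone_sort (f ∘ e)).strictMono_of_injective
      ((hf.comp e.injective).comp s.injective)
  let ρ : Equiv.Perm (SignedPoint n) := e.permCongr s
  have hρ : ∀ x y, x.height < y.height → f (ρ x) < f (ρ y) := by
    intro x y hxy
    have h1 : e.symm x < e.symm y := he.lt_iff_lt.1 (by simpa using hxy)
    simpa [ρ, Equiv.permCongr_apply] using hs h1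
  have hmem : ρ ∈ hyperoctahedral n := by
    intro x
    -- As `f` and `height` are odd, conjugating `ρ` by negation again sorts `f`; uniqueness makes
    -- `ρ` commute with negation.
    let F : Equiv.Perm (SignedPoint n) := ⟨flip, flip, flip_flip, flip_flip⟩
    have h1 := comp_eq_comp_of_monotone f ρ (F * ρ * F) (fun x y hxy => (hρ x y hxy).le) (by
      intro x y hxy
      have h2 := hρ y.flip x.flip (by simpa [height_flip] using hxy)
      simp only [F, Equiv.Perm.mul_apply, Equiv.coe_fn_mk, hodd]
      omega) x.flip
    simpa [F] using hf h1
  have hρ' : ∀ x y, f (ρ x) < f (ρ y) ↔ x.height < y.height := by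
    intro x y
    refine ⟨fun h => ?_, hρ x y⟩
    by_contra hxy
    rcases (not_lt.1 hxy).eq_or_lt with h1 | h1
    · rw [height_injective h1] at h
      exact lt_irrefl _ h
    · exact lt_asymm h (hρ _ _ h1)
  refine ⟨⟨ρ, hmem⟩⁻¹, fun x y => ?_⟩
  rw [← hρ']
  simp [Subgroup.smul_def]

end hyperoctahedral

/-! ### Blocks of a signed set -/

namespace SignedPoint

variable {n : ℕ}

open Classical in
/-- The block of `x` in the ordered partition with blocks `A`, the rest, and `-A`. -/
noncomputable def block (A : Set (SignedPoint n)) (x : SignedPoint n) : ℤ :=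
  (if x.flip ∈ A then 1 else 0) - (if x ∈ A then 1 else 0)

theorem block_flip (A : Set (SignedPoint n)) (x : SignedPoint n) :
    block A x.flip = -block A x := by
  rw [block, block, flip_flip]
  ring

theorem block_smul (g : hyperoctahedral n) (A : Set (SignedPoint n)) (x : SignedPoint n) :
    block (g • A) (g • x) = block A x := by
  rw [block, block, ← hyperoctahedral.apply_flip, Set.smul_mem_smul_set_iff,
    Set.smul_mem_smul_set_iff]

theorem block_eq_neg_one_iff {A : Set (SignedPoint n)} {x : SignedPoint n}
    (hA : ∀ x ∈ A, x.flip ∉ A) : block A x = -1 ↔ x ∈ A := by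
  have := hA x
  by_cases h1 : x ∈ A <;> by_cases h2 : x.flip ∈ A <;> simp_all [block]

/-- `σ` fixes the signed set `A` exactly when it preserves its blocks. -/
theorem smul_eq_iff_block {A : Set (SignedPoint n)} (hA : ∀ x ∈ A, x.flip ∉ A)
    (g : hyperoctahedral n) : g • A = A ↔ ∀ x, block A (g • x) = block A x := by
  constructor
  · intro h x
    conv_lhs => rw [← h]
    exact block_smul g A x
  · intro h
    have hmem : ∀ x, g • x ∈ A ↔ x ∈ A := fun x => by
      rw [← block_eq_neg_one_iff hA, h x, block_eq_neg_one_iff hA]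
    ext x
    rw [Set.mem_smul_set_iff_inv_smul_mem, ← hmem, smul_inv_smul]

end SignedPoint

/-! ### Moving signed sets to the top, and the decks fixed by such moves -/

namespace hyperoctahedral

open SignedPoint

variable {n : ℕ}

/-- The integer that orders the cards after the cards in `A` have been moved to the top of the
deck `σ`. -/
noncomputable def moveToTopKey (A : Set (SignedPoint n)) (σ : hyperoctahedral n)
    (x : SignedPoint n) : ℤ :=
  block A x * (2 * n + 1) + (σ • x).height

/-- Two heights differ by at most `2 * n`, so a block difference weighted by `2 * n + 1` always
dominates. -/
theorem moveToTopKey_lt_iff (A : Set (SignedPoint n)) (σ : hyperoctahedral n)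
    (x y : SignedPoint n) : moveToTopKey A σ x < moveToTopKey A σ y ↔
      block A x < block A y ∨ (block A x = block A y ∧ (σ • x).height < (σ • y).height) := by
  have hx := abs_le.1 (abs_height_le (σ • x))
  have hy := abs_le.1 (abs_height_le (σ • y))
  unfold moveToTopKey
  generalize block A x = a at *
  generalize block A y = b at *
  rcases lt_trichotomy a b with h | rfl | h
  · simp only [h, true_or, iff_true]
    nlinarith
  · simp
  · simp only [h.not_gt, h.ne', false_or, false_and, iff_false, not_lt]
    nlinarith

theorem moveToTopKey_injective (A : Set (SignedPoint n)) (σ : hyperoctahedral n) :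
    Function.Injective (moveToTopKey A σ) := by
  intro x y h
  have h1 := (moveToTopKey_lt_iff A σ x y).not.1 h.not_lt
  have h2 := (moveToTopKey_lt_iff A σ y x).not.1 h.not_gt
  apply MulAction.injective σ
  apply height_injective
  beta_reduce
  omega

theorem moveToTopKey_flip (A : Set (SignedPoint n)) (σ : hyperoctahedral n)
    (x : SignedPoint n) : moveToTopKey A σ x.flip = -moveToTopKey A σ x := by
  unfold moveToTopKey
  rw [block_flip, apply_flip, height_flip]
  ring

/-- The deck obtained from the deck `σ` by moving the signed cards in `A` to the top, in their
order in `σ`. -/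
noncomputable def moveToTop (A : Set (SignedPoint n)) (σ : hyperoctahedral n) :
    hyperoctahedral n :=
  (exists_height_lt_iff (moveToTopKey A σ) (moveToTopKey_injective A σ)
    (moveToTopKey_flip A σ)).choose

theorem moveToTop_lt_iff_key (A : Set (SignedPoint n)) (σ : hyperoctahedral n)
    (x y : SignedPoint n) : (moveToTop A σ • x).height < (moveToTop A σ • y).height ↔
      moveToTopKey A σ x < moveToTopKey A σ y :=
  (exists_height_lt_iff (moveToTopKey A σ) (moveToTopKey_injective A σ)
    (moveToTopKey_flip A σ)).choose_spec x y

theorem moveToTop_lt_iff (A : Set (SignedPoint n)) (σ : hyperoctahedral n)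
    (x y : SignedPoint n) : (moveToTop A σ • x).height < (moveToTop A σ • y).height ↔
      block A x < block A y ∨ (block A x = block A y ∧ (σ • x).height < (σ • y).height) := by
  rw [moveToTop_lt_iff_key, moveToTopKey_lt_iff]

/-- Relabelling the cards by `τ` carries the blocks of `A` to those of `τ • A`. Hence moving `A` to
the top is left multiplication by an element that depends only on the positions of `A` in the deck.
-/
theorem moveToTop_mul (A : Set (SignedPoint n)) (σ τ : hyperoctahedral n) :
    moveToTop A (σ * τ) = moveToTop (τ • A) σ * τ := by
  apply eq_of_height_lt_imp
  intro x y h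
  rw [moveToTop_lt_iff] at h
  rw [mul_smul, mul_smul, moveToTop_lt_iff, block_smul, block_smul, ← mul_smul, ← mul_smul]
  exact h

/-- Move the sets in the list `l` to the top, one after the other, starting with the last one. -/
noncomputable def moveAllToTop (l : List (Set (SignedPoint n))) (σ : hyperoctahedral n) :
    hyperoctahedral n :=
  l.foldr moveToTop σ

@[simp] theorem moveAllToTop_nil (σ : hyperoctahedral n) : moveAllToTop [] σ = σ := rfl

@[simp] theorem moveAllToTop_cons (A : Set (SignedPoint n)) (l : List (Set (SignedPoint n)))
    (σ : hyperoctahedral n) : moveAllToTop (A :: l) σ = moveToTop A (moveAllToTop l σ) := rfl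

/-- The blocks of `x` with respect to the sets in the list `l`. -/
noncomputable def blocks (l : List (Set (SignedPoint n))) (x : SignedPoint n) : List ℤ :=
  l.map fun A => block A x

/-- The last move dominates; it belongs to the head of `l`, so the blocks are compared
lexicographically. -/
theorem moveAllToTop_lt_iff (l : List (Set (SignedPoint n))) (σ : hyperoctahedral n)
    (x y : SignedPoint n) : (moveAllToTop l σ • x).height < (moveAllToTop l σ • y).height ↔
      blocks l x < blocks l y ∨ (blocks l x = blocks l y ∧ (σ • x).height < (σ • y).height) := by
  induction l with
  | nil => simp [blocks]
  | cons A l ih =>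
    rw [moveAllToTop_cons, moveToTop_lt_iff, ih]
    simp only [blocks, List.map_cons, List.cons_lt_cons_iff, List.cons.injEq]
    tauto

theorem moveAllToTop_eq_self_iff (l : List (Set (SignedPoint n))) (σ : hyperoctahedral n) :
    moveAllToTop l σ = σ ↔
      ∀ x y, (σ • x).height < (σ • y).height → blocks l x ≤ blocks l y := by
  constructor
  · intro h x y hxy
    rw [← h, moveAllToTop_lt_iff] at hxy
    rcases hxy with h | h
    exacts [h.le, h.1.le]
  · intro h
    symm
    apply eq_of_height_lt_imp
    intro x y hxy
    rw [moveAllToTop_lt_iff]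
    rcases (h x y hxy).lt_or_eq with h1 | h1
    exacts [Or.inl h1, Or.inr ⟨h1, hxy⟩]

theorem moveAllToTop_moveAllToTop (l : List (Set (SignedPoint n))) (σ : hyperoctahedral n) :
    moveAllToTop l (moveAllToTop l σ) = moveAllToTop l σ := by
  rw [moveAllToTop_eq_self_iff]
  intro x y h
  rw [moveAllToTop_lt_iff] at h
  rcases h with h | h
  exacts [h.le, h.1.le]

/-- If the sorted deck `ρ` is fixed by moving the sets in `l` to the top, the decks fixed in this
way are those obtained from `ρ` by permuting the cards within their blocks. -/
theorem moveAllToTop_mul_eq_self_iff {l : List (Set (SignedPoint n))} {ρ : hyperoctahedral n}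
    (hρ : moveAllToTop l ρ = ρ) (τ : hyperoctahedral n) :
    moveAllToTop l (ρ * τ) = ρ * τ ↔ ∀ x, blocks l (τ • x) = blocks l x := by
  rw [moveAllToTop_eq_self_iff] at hρ ⊢
  constructor
  · intro h x
    -- Both inverse decks list the points with increasing blocks, so they show the same blocks at
    -- each place.
    have key := comp_eq_comp_of_monotone (blocks l) (ρ⁻¹ : hyperoctahedral n).1
      ((ρ * τ)⁻¹ : hyperoctahedral n).1
      (fun x y hxy => hρ (ρ⁻¹ • x) (ρ⁻¹ • y) (by simpa using hxy))
      (fun x y hxy => h ((ρ * τ)⁻¹ • x) ((ρ * τ)⁻¹ • y) (by simpa only [smul_inv_smul] using hxy))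
      ((ρ * τ) • x)
    change blocks l (ρ⁻¹ • (ρ * τ) • x) = blocks l ((ρ * τ)⁻¹ • (ρ * τ) • x) at key
    rwa [mul_smul, inv_smul_smul, ← mul_smul ρ, inv_smul_smul] at key
  · intro h x y hxy
    rw [← h x, ← h y]
    exact hρ _ _ (by simpa only [mul_smul] using hxy)

/-- As many decks are fixed by moving the sets in `l` to the top as there are signed permutations
that fix every set in `l`. -/
theorem card_moveAllToTop_eq_self (l : List (Set (SignedPoint n)))
    (hl : ∀ A ∈ l, ∀ x ∈ A, x.flip ∉ A) :
    Nat.card {σ : hyperoctahedral n // moveAllToTop l σ = σ} =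
      Nat.card {τ : hyperoctahedral n // ∀ A ∈ l, τ • A = A} := by
  symm
  refine Nat.card_congr ((Equiv.mulLeft (moveAllToTop l 1)).subtypeEquiv fun τ => ?_)
  rw [Equiv.coe_mulLeft, moveAllToTop_mul_eq_self_iff (moveAllToTop_moveAllToTop l 1)]
  simp only [blocks, List.map_inj_left]
  constructor
  · intro h x A hA
    exact (smul_eq_iff_block (hl A hA) τ).1 (h A hA) x
  · intro h A hA
    exact (smul_eq_iff_block (hl A hA) τ).2 fun x => h x A hA

end hyperoctahedral

/-! ### Matrix powers as sums over words, and cosets as orbit points -/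

section Words

variable {α X : Type*} [Fintype α] [Fintype X] [DecidableEq X]

theorem Matrix.pow_apply_eq_sum_words {R : Type*} [CommSemiring R] (act : α → X → X) (m : ℕ)
    (x y : X) :
    ((Matrix.of fun x y => ∑ a, if act a x = y then (1 : R) else 0) ^ m) x y =
      ∑ t : Fin m → α, if (List.ofFn t).foldr act x = y then 1 else 0 := by
  induction m generalizing y with
  | zero => simp [Matrix.one_apply]
  | succ m ih =>
    rw [pow_succ, Matrix.mul_apply, ← (Fin.consEquiv fun _ => α).sum_comp, Fintype.sum_prod_type,
      Finset.sum_comm]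
    simp only [ih, Finset.sum_mul, Matrix.of_apply]
    rw [Finset.sum_comm]
    refine Finset.sum_congr rfl fun t _ => ?_
    simp [Fin.consEquiv]

end Words

theorem permutationCharacter_stabilizer {G X : Type*} [Group G] [MulAction G X] (x : X) (τ : G) :
    permutationCharacter (MulAction.stabilizer G x) τ =
      Nat.card {y : MulAction.orbit G x // τ • (y : X) = y} := by
  symm
  refine Nat.card_congr ((MulAction.orbitEquivQuotientStabilizer G x).subtypeEquiv fun y => ?_)
  rw [MulAction.mem_fixedBy]
  obtain ⟨q, rfl⟩ := (MulAction.orbitEquivQuotientStabilizer G x).symm.surjective y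
  rw [Equiv.apply_symm_apply]
  induction q using QuotientGroup.induction_on with
  | H g =>
    rw [MulAction.orbitEquivQuotientStabilizer_symm_apply]
    change _ ↔ ((τ * g : G) : G ⧸ MulAction.stabilizer G x) = _
    rw [← (MulAction.orbitEquivQuotientStabilizer G x).symm.injective.eq_iff, Subtype.ext_iff,
      MulAction.orbitEquivQuotientStabilizer_symm_apply,
      MulAction.orbitEquivQuotientStabilizer_symm_apply, mul_smul]

/-! ### The orbit of the top `k` cards -/

namespace SignedPoint

variable {n : ℕ}

theorem flip_one (i : Fin n) : flip ((i, 1) : SignedPoint n) = (i, -1) := rfl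

theorem eq_or_eq_flip_of_fst_eq {x y : SignedPoint n} (h : x.1 = y.1) : x = y ∨ x = flip y := by
  rcases Int.units_eq_one_or x.2 with h1 | h1 <;>
  rcases Int.units_eq_one_or y.2 with h2 | h2 <;>
  simp [flip, Prod.ext_iff, h1, h2, h]

/-- The first `k` cards, face-up. -/
def topSet (n k : ℕ) : Set (SignedPoint n) := {x | (x.1 : ℕ) < k ∧ x.2 = 1}

/-- The cards in `R`, where those in `F` are face-down and the others are face-up. -/
def signedSet (R F : Finset (Fin n)) : Set (SignedPoint n) :=
  {x | x.1 ∈ R ∧ (x.2 = 1 ↔ x.1 ∉ F)}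

theorem one_mem_signedSet {R F : Finset (Fin n)} {i : Fin n} :
    (i, 1) ∈ signedSet R F ↔ i ∈ R ∧ i ∉ F := by
  simp [signedSet]

theorem neg_one_mem_signedSet {R F : Finset (Fin n)} {i : Fin n} :
    (i, -1) ∈ signedSet R F ↔ i ∈ R ∧ i ∈ F := by
  simp [signedSet]

theorem signedSet_inj {R F R' F' : Finset (Fin n)} (hF : F ⊆ R) (hF' : F' ⊆ R')
    (h : signedSet R F = signedSet R' F') : R = R' ∧ F = F' := by
  have h1 : ∀ i, i ∈ R ∧ i ∉ F ↔ i ∈ R' ∧ i ∉ F' := fun i => by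
    rw [← one_mem_signedSet, h, one_mem_signedSet]
  have h2 : ∀ i, i ∈ R ∧ i ∈ F ↔ i ∈ R' ∧ i ∈ F' := fun i => by
    rw [← neg_one_mem_signedSet, h, neg_one_mem_signedSet]
  constructor <;> ext i <;> have := h1 i <;> have := h2 i <;> have := @hF i <;>
    have := @hF' i <;> tauto

theorem block_signedSet_one {R F : Finset (Fin n)} (hF : F ⊆ R) (i : Fin n) :
    block (signedSet R F) (i, 1) = if i ∈ F then 1 else if i ∈ R then -1 else 0 := by
  have := @hF i
  rw [block, flip_one, one_mem_signedSet, neg_one_mem_signedSet]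
  by_cases hi : i ∈ F <;> by_cases hi' : i ∈ R <;> simp_all

theorem block_signedSet_neg_one {R F : Finset (Fin n)} (hF : F ⊆ R) (i : Fin n) :
    block (signedSet R F) (i, -1) = if i ∈ F then -1 else if i ∈ R then 1 else 0 := by
  rw [← flip_one, block_flip, block_signedSet_one hF]
  split_ifs <;> simp

theorem flip_notMem_of_mem_orbit {k : ℕ} {A : Set (SignedPoint n)}
    (hA : A ∈ MulAction.orbit (hyperoctahedral n) (topSet n k)) : ∀ x ∈ A, x.flip ∉ A := by
  obtain ⟨g, rfl⟩ := hA
  rintro _ ⟨x, hx, rfl⟩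
  change (g • x).flip ∉ g • topSet n k
  rw [← hyperoctahedral.apply_flip, Set.smul_mem_smul_set_iff]
  have := hx.2
  rintro ⟨-, h⟩
  simp [flip, this] at h

theorem exists_eq_signedSet_of_mem_orbit {k : ℕ} (hkn : k ≤ n) {A : Set (SignedPoint n)}
    (hA : A ∈ MulAction.orbit (hyperoctahedral n) (topSet n k)) :
    ∃ R F : Finset (Fin n), R.card = k ∧ F ⊆ R ∧ signedSet R F = A := by
  classical
  have hA' := flip_notMem_of_mem_orbit hA
  obtain ⟨g, rfl⟩ := hA
  let π : Fin n → Fin n := fun i => (g • ((i, 1) : SignedPoint n)).1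
  have hπ : Function.Injective π := by
    intro i j hij
    have h : g • ((i, 1) : SignedPoint n) = g • ((j, 1) : SignedPoint n) ∨
        g • ((i, 1) : SignedPoint n) = g • flip ((j, 1) : SignedPoint n) := by
      rw [hyperoctahedral.apply_flip]
      exact eq_or_eq_flip_of_fst_eq hij
    rcases h with h | h
    · exact congrArg Prod.fst (MulAction.injective g h)
    · exact congrArg Prod.fst (MulAction.injective g h)
  let R : Finset (Fin n) := (Finset.univ.filter fun i : Fin n => (i : ℕ) < k).image π
  have hR : ∀ i, i ∈ R ↔
      ((i, 1) : SignedPoint n) ∈ g • topSet n k ∨ ((i, -1) : SignedPoint n) ∈ g • topSet n k := by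
    intro i
    simp only [R, Finset.mem_image, Finset.mem_filter, Finset.mem_univ, true_and]
    constructor
    · rintro ⟨j, hj, rfl⟩
      have h1 : g • ((j, 1) : SignedPoint n) ∈ g • topSet n k :=
        Set.smul_mem_smul_set ⟨hj, rfl⟩
      rcases Int.units_eq_one_or (g • ((j, 1) : SignedPoint n)).2 with h2 | h2
      · left
        rwa [← h2]
      · right
        rwa [← h2]
    · rintro (⟨⟨j, ε⟩, ⟨hj, hε⟩, h⟩ | ⟨⟨j, ε⟩, ⟨hj, hε⟩, h⟩) <;>
      · change ε = 1 at hε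
        subst hε
        exact ⟨j, hj, congrArg Prod.fst h⟩
  refine ⟨R, R.filter fun i => ((i, -1) : SignedPoint n) ∈ g • topSet n k, ?_,
    Finset.filter_subset _ _, ?_⟩
  · rw [Finset.card_image_of_injective _ hπ, Fin.card_filter_val_lt, min_eq_right hkn]
  · ext ⟨i, ε⟩
    have h1 := hA' (i, 1)
    rcases Int.units_eq_one_or ε with rfl | rfl
    · rw [one_mem_signedSet, Finset.mem_filter, hR]
      change _ → ((i, -1) : SignedPoint n) ∉ _ at h1
      tauto
    · rw [neg_one_mem_signedSet, Finset.mem_filter, hR]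
      tauto

end SignedPoint

/-! ### Oriented shuffles as moves to the top -/

namespace hyperoctahedral

open SignedPoint

variable {n : ℕ}

theorem deckAfter_injective : Function.Injective (deckAfter : hyperoctahedral n → _) := by
  intro σ τ h
  have h1 := List.ofFn_injective h
  have h2 : ∀ p : Fin n, σ⁻¹ • ((p, 1) : SignedPoint n) = τ⁻¹ • ((p, 1) : SignedPoint n) :=
    fun p => congrFun h1 p
  apply inv_injective
  ext1
  ext1 ⟨p, ε⟩
  rcases Int.units_eq_one_or ε with rfl | rfl
  · exact h2 p
  · change σ⁻¹ • ((p, -1) : SignedPoint n) = τ⁻¹ • ((p, -1) : SignedPoint n)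
    rw [← flip_one, apply_flip, apply_flip, h2]

theorem mem_deckAfter {σ : hyperoctahedral n} {x : SignedPoint n} :
    x ∈ deckAfter σ ↔ (σ • x).2 = 1 := by
  rw [deckAfter, List.mem_ofFn]
  constructor
  · rintro ⟨p, rfl⟩
    change (σ • σ⁻¹ • ((p, 1) : SignedPoint n)).2 = 1
    rw [smul_inv_smul]
  · intro h
    refine ⟨(σ • x).1, ?_⟩
    change σ⁻¹ • (((σ • x).1, 1) : SignedPoint n) = x
    rw [inv_smul_eq_iff, ← h]

theorem pairwise_deckAfter_moveToTop (A : Set (SignedPoint n)) (σ : hyperoctahedral n) :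
    (deckAfter (moveToTop A σ)).Pairwise fun x y => moveToTopKey A σ x < moveToTopKey A σ y := by
  rw [deckAfter, List.pairwise_ofFn]
  intro i j hij
  rw [← moveToTop_lt_iff_key]
  change height (moveToTop A σ • (moveToTop A σ)⁻¹ • ((i, 1) : SignedPoint n)) <
    height (moveToTop A σ • (moveToTop A σ)⁻¹ • ((j, 1) : SignedPoint n))
  rw [smul_inv_smul, smul_inv_smul]
  simpa [height] using hij

theorem mem_shuffledDeck_one {R F : Finset (Fin n)} (hF : F ⊆ R) (i : Fin n) :
    (i, 1) ∈ shuffledDeck R F ↔ i ∉ F := by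
  have := @hF i
  simp [shuffledDeck]
  tauto

theorem mem_shuffledDeck_neg_one {R F : Finset (Fin n)} (i : Fin n) :
    (i, -1) ∈ shuffledDeck R F ↔ i ∈ F := by
  simp [shuffledDeck]

theorem mem_deckAfter_moveToTop {A : Set (SignedPoint n)} {x : SignedPoint n} :
    x ∈ deckAfter (moveToTop A 1) ↔ block A x < 0 ∨ (block A x = 0 ∧ x.2 = 1) := by
  -- Since `height` is odd, a point is face-up exactly when it precedes its negative, so the order
  -- alone decides membership.
  have h1 : (moveToTop A 1 • x).height < 0 ↔
      (moveToTop A 1 • x).height < (moveToTop A 1 • x.flip).height := by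
    rw [apply_flip, height_flip]
    omega
  rw [mem_deckAfter, ← height_neg_iff, h1, moveToTop_lt_iff, block_flip, ← height_neg_iff,
    one_smul, one_smul, height_flip]
  omega

/-- Face-down points have heights above all face-up ones, decreasing in the index. Within the block
of `A` the flipped cards therefore follow the unflipped ones, in reverse order. -/
theorem pairwise_shuffledDeck {R F : Finset (Fin n)} (hF : F ⊆ R) :
    (shuffledDeck R F).Pairwise fun x y =>
      moveToTopKey (signedSet R F) 1 x < moveToTopKey (signedSet R F) 1 y := by
  have hlt : (List.finRange n).Pairwise (· < ·) := List.pairwise_lt_finRange n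
  simp only [moveToTopKey_lt_iff, one_smul]
  rw [shuffledDeck, List.pairwise_append, List.pairwise_append]
  simp only [List.pairwise_map, List.pairwise_reverse, List.mem_append, List.mem_map,
    List.mem_filter, List.mem_finRange, true_and, List.mem_reverse, decide_eq_true_eq]
  refine ⟨⟨?_, ?_, ?_⟩, ?_, ?_⟩
  · refine (hlt.filter _).imp_of_mem fun {i j} hi hj hij => ?_
    simp only [List.mem_filter, decide_eq_true_eq] at hi hj
    right
    simp only [block_signedSet_one hF, hi.2, hj.2, height]
    simpa using hij
  · refine (hlt.filter _).imp_of_mem fun {i j} hi hj hij => ?_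
    simp only [List.mem_filter, decide_eq_true_eq] at hi hj
    right
    simp only [block_signedSet_neg_one hF, hi.2, hj.2, height]
    simpa using hij
  · rintro _ ⟨i, hi, rfl⟩ _ ⟨j, hj, rfl⟩
    have := hF hj
    right
    simp [block_signedSet_one hF, block_signedSet_neg_one hF, hi, hj, height]
    omega
  · refine (hlt.filter _).imp_of_mem fun {i j} hi hj hij => ?_
    simp only [List.mem_filter, decide_eq_true_eq] at hi hj
    have h1 : i ∉ F := fun h => hi.2 (hF h)
    have h2 : j ∉ F := fun h => hj.2 (hF h)
    right
    simp only [block_signedSet_one hF, hi.2, hj.2, h1, h2, height]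
    simpa using hij
  · rintro _ (⟨i, hi, rfl⟩ | ⟨i, hi, rfl⟩) _ ⟨j, hj, rfl⟩ <;>
    · have h2 : j ∉ F := fun h => hj (hF h)
      left
      simp [block_signedSet_one hF, block_signedSet_neg_one hF, hi, hj, h2]

/-- Both lists have the same members and are strictly sorted by the same key. -/
theorem deckAfter_moveToTop {R F : Finset (Fin n)} (hF : F ⊆ R) :
    deckAfter (moveToTop (signedSet R F) 1) = shuffledDeck R F := by
  have h1 := pairwise_deckAfter_moveToTop (signedSet R F) 1
  have h2 := pairwise_shuffledDeck hF
  refine List.Perm.eq_of_pairwise (fun x y _ _ hx hy => absurd hx hy.asymm) h1 h2 ?_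
  rw [List.perm_ext_iff_of_nodup (h1.imp fun h e => by simp [e] at h)
    (h2.imp fun h e => by simp [e] at h)]
  rintro ⟨i, ε⟩
  have := @hF i
  rw [mem_deckAfter_moveToTop]
  rcases Int.units_eq_one_or ε with rfl | rfl
  · rw [block_signedSet_one hF, mem_shuffledDeck_one hF]
    split_ifs <;> simp_all
  · rw [block_signedSet_neg_one hF, mem_shuffledDeck_neg_one]
    split_ifs <;> simp_all

/-- The first `R.card` entries of the shuffled deck are exactly the signed set. It can thus be
recovered from the shuffle, which gives the count of shuffles. -/
theorem moveToTop_smul_signedSet {R F : Finset (Fin n)} (hF : F ⊆ R) :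
    moveToTop (signedSet R F) 1 • signedSet R F = topSet n R.card := by
  set s := moveToTop (signedSet R F) 1 with hs
  have hdeck : deckAfter s = shuffledDeck R F := deckAfter_moveToTop hF
  have hlen : ∀ P : Fin n → Prop, ∀ _ : DecidablePred P,
      ((List.finRange n).filter fun i => P i).length = (Finset.univ.filter P).card := by
    intro P _
    rfl
  have htake : ∀ x, x ∈ (shuffledDeck R F).take R.card ↔ x ∈ signedSet R F := by
    rw [shuffledDeck, List.take_left']
    · rintro ⟨i, ε⟩
      have := @hF i
      rcases Int.units_eq_one_or ε with rfl | rfl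
      · rw [one_mem_signedSet]
        simp
      · rw [neg_one_mem_signedSet]
        simpa using this
    · rw [List.length_append, List.length_map, List.length_map, List.length_reverse, hlen, hlen]
      have h1 : (Finset.univ.filter fun i => i ∈ R ∧ i ∉ F) = R \ F := by ext; simp
      have h2 : (Finset.univ.filter fun i => i ∈ F) = F := by ext; simp
      rw [h1, h2, Finset.card_sdiff_add_card_eq_card hF]
  ext x
  rw [Set.mem_smul_set_iff_inv_smul_mem, ← htake, ← hdeck, List.mem_take_iff_getElem]
  simp only [deckAfter, List.getElem_ofFn, List.length_ofFn]
  constructor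
  · rintro ⟨i, hi, h⟩
    have h' : s⁻¹ • (((⟨i, by omega⟩ : Fin n), 1) : SignedPoint n) = s⁻¹ • x := h
    rw [← MulAction.injective _ h']
    exact ⟨by simp; omega, rfl⟩
  · obtain ⟨i, ε⟩ := x
    rintro ⟨hi, hε⟩
    change ε = 1 at hε
    subst hε
    have := i.2
    change (i : ℕ) < _ at hi
    exact ⟨i, by omega, rfl⟩

theorem mem_orientedShuffles {k : ℕ} {s : hyperoctahedral n} :
    s ∈ orientedShuffles n k ↔
      ∃ R F : Finset (Fin n), R.card = k ∧ F ⊆ R ∧ moveToTop (signedSet R F) 1 = s := by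
  rw [orientedShuffles, Finset.mem_filter, and_iff_right (Finset.mem_univ s), IsOrientedShuffle]
  refine exists₂_congr fun R F => and_congr_right fun _ => and_congr_right fun hF => ?_
  rw [← deckAfter_moveToTop hF, deckAfter_injective.eq_iff, eq_comm]

/-- Every oriented shuffle moves exactly one signed set of size `k` to the top. -/
theorem moveToTop_one_eq_iff {k : ℕ} (hkn : k ≤ n)
    {A : Set (SignedPoint n)} (hA : A ∈ MulAction.orbit (hyperoctahedral n) (topSet n k))
    (s : hyperoctahedral n) :
    moveToTop A 1 = s ↔ s ∈ orientedShuffles n k ∧ A = s⁻¹ • topSet n k := by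
  rw [mem_orientedShuffles]
  constructor
  · rintro rfl
    obtain ⟨R, F, rfl, hF, rfl⟩ := exists_eq_signedSet_of_mem_orbit hkn hA
    exact ⟨⟨R, F, rfl, hF, rfl⟩, by rw [← moveToTop_smul_signedSet hF, inv_smul_smul]⟩
  · rintro ⟨⟨R, F, rfl, hF, rfl⟩, rfl⟩
    rw [← moveToTop_smul_signedSet hF, inv_smul_smul]

theorem card_orientedShuffles (n k : ℕ) :
    (orientedShuffles n k).card = 2 ^ k * n.choose k := by
  have h1 : orientedShuffles n k =
      ((Finset.powersetCard k (Finset.univ : Finset (Fin n))).sigma Finset.powerset).image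
        fun p => moveToTop (signedSet p.1 p.2) 1 := by
    ext s
    simp only [mem_orientedShuffles, Finset.mem_image, Finset.mem_sigma, Finset.mem_powersetCard,
      Finset.subset_univ, true_and, Finset.mem_powerset, Sigma.exists, and_assoc]
  rw [h1, Finset.card_image_of_injOn, Finset.card_sigma,
    Finset.sum_congr rfl fun R hR => by
      rw [Finset.card_powerset, (Finset.mem_powersetCard.1 hR).2]]
  · simp [mul_comm]
  · rintro ⟨R, F⟩ h ⟨R', F'⟩ h' heq
    simp only [Finset.coe_sigma, Set.mem_sigma_iff, Finset.mem_coe, Finset.mem_powersetCard,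
      Finset.subset_univ, true_and, Finset.mem_powerset] at h h' heq
    have e1 := moveToTop_smul_signedSet h.2
    rw [heq, h.1, ← h'.1, ← moveToTop_smul_signedSet h'.2] at e1
    obtain ⟨rfl, rfl⟩ := signedSet_inj h.2 h'.2 (MulAction.injective _ e1)
    rfl

/-- Moving the top `k` cards to the top changes nothing. -/
theorem one_mem_orientedShuffles {k : ℕ} (hkn : k ≤ n) :
    (1 : hyperoctahedral n) ∈ orientedShuffles n k := by
  refine ((moveToTop_one_eq_iff hkn (MulAction.mem_orbit_self (topSet n k)) 1).1 ?_).1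
  have hval : ∀ i : Fin n, block (topSet n k) (i, 1) = if (i : ℕ) < k then -1 else 0 := by
    intro i
    have h1 : ((i, 1) : SignedPoint n) ∈ topSet n k ↔ (i : ℕ) < k := by simp [topSet]
    have h2 : ((i, -1) : SignedPoint n) ∉ topSet n k := by simp [topSet]
    rw [block, flip_one, if_neg h2]
    simp only [h1]
    split_ifs <;> simp
  have hval' : ∀ i : Fin n, block (topSet n k) (i, -1) = if (i : ℕ) < k then 1 else 0 := by
    intro i
    rw [← flip_one, block_flip, hval]
    split_ifs <;> simp
  symm
  apply eq_of_height_lt_imp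
  intro x y hxy
  rw [moveToTop_lt_iff]
  refine lt_or_eq_of_le ?_ |>.imp_right fun h => ⟨h, hxy⟩
  obtain ⟨i, ε⟩ := x
  obtain ⟨j, δ⟩ := y
  have := i.2
  have := j.2
  simp only [one_smul] at hxy
  rcases Int.units_eq_one_or ε with rfl | rfl <;> rcases Int.units_eq_one_or δ with rfl | rfl <;>
    simp only [hval, hval', height] at hxy ⊢ <;> simp at hxy <;> split_ifs <;> omega

-- By `moveToTop_mul`, moving `A` in the deck `σ` applies the shuffle for `σ • A`. If `τ * σ⁻¹` is a
-- shuffle, the only possible `A` is the set of cards on top of `τ`.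
open Classical in
theorem sum_moveToTop_eq {k : ℕ} (hkn : k ≤ n) (σ τ : hyperoctahedral n) :
    (∑ A : MulAction.orbit (hyperoctahedral n) (topSet n k),
      if moveToTop (A : Set (SignedPoint n)) σ = τ then (1 : ℝ) else 0) =
      if τ * σ⁻¹ ∈ orientedShuffles n k then 1 else 0 := by
  have h1 : ∀ A : MulAction.orbit (hyperoctahedral n) (topSet n k),
      moveToTop (A : Set (SignedPoint n)) σ = τ ↔ τ * σ⁻¹ ∈ orientedShuffles n k ∧
        A = τ⁻¹ • (⟨topSet n k, MulAction.mem_orbit_self _⟩ :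
          MulAction.orbit (hyperoctahedral n) (topSet n k)) := by
    intro A
    have h2 : moveToTop (A : Set (SignedPoint n)) σ = moveToTop (σ • (A : Set (SignedPoint n))) 1 * σ := by
      rw [← moveToTop_mul, one_mul]
    rw [h2, ← eq_mul_inv_iff_mul_eq,
      moveToTop_one_eq_iff hkn (A := σ • (A : Set (SignedPoint n))) (σ • A).2, Subtype.ext_iff,
      MulAction.orbit.coe_smul, mul_inv_rev, inv_inv, mul_smul, smul_left_cancel_iff]
  simp only [h1]
  split_ifs with h <;> simp [h]

/-- Both sides become sums over words of `m` signed sets: the left counts the decks fixed by the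
moves, the right the signed permutations fixing all the sets. -/
theorem trace_pow_orientedShuffles {k : ℕ} (hkn : k ≤ n) (m : ℕ) :
    ((Matrix.of fun σ τ : hyperoctahedral n =>
      if τ * σ⁻¹ ∈ orientedShuffles n k then (1 : ℝ) else 0) ^ m).trace =
      ∑ τ, (permutationCharacter (parabolicSubgroup n k) τ : ℝ) ^ m := by
  classical
  have hperm : ∀ τ, (permutationCharacter (parabolicSubgroup n k) τ : ℝ) =
      ∑ A : MulAction.orbit (hyperoctahedral n) (topSet n k),
        if τ • (A : Set (SignedPoint n)) = A then (1 : ℝ) else 0 := by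
    intro τ
    change (permutationCharacter
      (MulAction.stabilizer (hyperoctahedral n) (topSet n k)) τ : ℝ) = _
    rw [permutationCharacter_stabilizer, Nat.card_eq_fintype_card, Fintype.card_subtype,
      Finset.sum_boole]
  simp only [← sum_moveToTop_eq hkn, hperm, Fintype.sum_pow]
  simp only [Matrix.trace, Matrix.diag_apply]
  rw [Finset.sum_congr rfl fun σ _ => Matrix.pow_apply_eq_sum_words
    (fun (A : MulAction.orbit (hyperoctahedral n) (topSet n k)) => moveToTop (A : Set _)) m σ σ,
    Finset.sum_comm, Finset.sum_comm (s := (Finset.univ : Finset (hyperoctahedral n)))]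
  refine Finset.sum_congr rfl fun t _ => ?_
  have key := card_moveAllToTop_eq_self (List.ofFn fun i => (t i : Set (SignedPoint n))) (by
    intro A hA
    obtain ⟨i, rfl⟩ := List.mem_ofFn.1 hA
    exact flip_notMem_of_mem_orbit (t i).2)
  have hfold : ∀ σ : hyperoctahedral n,
      (List.ofFn t).foldr (fun A : MulAction.orbit (hyperoctahedral n) (topSet n k) =>
        moveToTop (A : Set (SignedPoint n))) σ =
        moveAllToTop (List.ofFn fun i => (t i : Set (SignedPoint n))) σ := by
    intro σ
    rw [moveAllToTop, show (fun i => (t i : Set (SignedPoint n))) = Subtype.val ∘ t from rfl, ← List.map_ofFn,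
      List.foldr_map]
  rw [Nat.card_eq_fintype_card, Nat.card_eq_fintype_card, Fintype.card_subtype,
    Fintype.card_subtype] at key
  simp only [hfold, Finset.prod_boole, Finset.sum_boole, Finset.mem_univ, true_imp_iff]
  rw [key]
  simp [List.mem_ofFn]

end hyperoctahedral

/-! ### Normalization and conclusion -/

theorem uniformStepMatrix_eq_smul {G : Type*} [Group G] [DecidableEq G] (S : Finset G) :
    uniformStepMatrix S =
      (S.card : ℝ)⁻¹ • Matrix.of fun σ τ : G => if τ * σ⁻¹ ∈ S then (1 : ℝ) else 0 := by
  ext σ τ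
  simp [uniformStepMatrix]

/-- The identity step contributes exactly the identity matrix, so removing it subtracts `1`. -/
theorem uniformStepMatrix_erase_one {G : Type*} [Group G] [DecidableEq G] {S : Finset G}
    (h1 : 1 ∈ S) :
    uniformStepMatrix (S.erase 1) =
      ((S.card : ℝ) - 1)⁻¹ •
        ((Matrix.of fun σ τ : G => if τ * σ⁻¹ ∈ S then (1 : ℝ) else 0) - 1) := by
  ext σ τ
  have hcard : ((S.erase 1).card : ℝ) = S.card - 1 := by
    rw [Finset.card_erase_of_mem h1, Nat.cast_pred (Finset.card_pos.2 ⟨1, h1⟩)]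
  by_cases h : σ = τ
  · subst h
    simp [uniformStepMatrix, h1]
  · have h' : τ * σ⁻¹ ≠ 1 := fun e => h (mul_inv_eq_one.1 e).symm
    simp [uniformStepMatrix, h, h', hcard]

/-- Both lists of eigenvalues are equalities of multisets, so they include multiplicities; each
multiset has as many elements as the group, so no eigenvalue over any larger field is missing. -/
theorem proposition4p6 (n k : ℕ) (hk : 1 ≤ k) (hkn : k ≤ n) :
    (uniformStepMatrix (orientedShuffles n k)).charpoly.roots =
      (Finset.univ : Finset (hyperoctahedral n)).val.map
        (fun τ => (permutationCharacter (parabolicSubgroup n k) τ : ℝ) /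
          (2 ^ k * (n.choose k : ℝ))) ∧
    (uniformStepMatrix ((orientedShuffles n k).erase 1)).charpoly.roots =
      (Finset.univ : Finset (hyperoctahedral n)).val.map
        (fun τ => ((permutationCharacter (parabolicSubgroup n k) τ : ℝ) - 1) /
          (2 ^ k * (n.choose k : ℝ) - 1)) := by
  have hcard : ((orientedShuffles n k).card : ℝ) = 2 ^ k * (n.choose k : ℝ) := by
    rw [hyperoctahedral.card_orientedShuffles]
    push_cast
    rfl
  have hroots := Matrix.roots_charpoly_aeval_of_trace_pow _
    (fun τ => (permutationCharacter (parabolicSubgroup n k) τ : ℝ))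
    (hyperoctahedral.trace_pow_orientedShuffles hkn)
  constructor
  · rw [uniformStepMatrix_eq_smul, hcard]
    have h := hroots (Polynomial.C (2 ^ k * (n.choose k : ℝ))⁻¹ * Polynomial.X)
    rw [map_mul, Polynomial.aeval_C, Polynomial.aeval_X, ← Algebra.smul_def] at h
    rw [h]
    simp [div_eq_inv_mul]
  · rw [uniformStepMatrix_erase_one (hyperoctahedral.one_mem_orientedShuffles hkn), hcard]
    have h := hroots (Polynomial.C (2 ^ k * (n.choose k : ℝ) - 1)⁻¹ * (Polynomial.X - 1))
    rw [map_mul, Polynomial.aeval_C, map_sub, Polynomial.aeval_X, map_one, ← Algebra.smul_def] at h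
    rw [h]
    simp [div_eq_inv_mul]
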